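/- Let $(M,g)$ be a connected smooth Riemannian manifold (finite-dimensional, without boundary) with Levi-Civita connection $\nabla$ and curvature $R(U,V)W=\nabla_U\nabla_VW-\nabla_V\nabla_UW-\nabla_{[U,V]}W$, and let $X$ be a smooth vector field on $M$. Suppose that $X$ is a global Jacobi field, that is, for every geodesic $\gamma\colon J\to M$ ($J\subseteq\mathbb R$ an open interval) the restriction $X\circ\gamma$ is a Jacobi field along $\gamma$: $$D_tD_t(X\circ\gamma)+R(X\circ\gamma,\dot\gamma)\dot\gamma=0\quad\text{on } J,$$ where $D_t$ denotes the covariant derivative along $\gamma$. Then the divergence $\operatorname{div}X=\operatorname{tr}(V\mapsto\nabla_VX)$ is constant on $M$: there is $c\in\mathbb R$ with $\operatorname{div}X(p)=c$ for all $p\in M$. -/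

import Mathlib

open Bundle FiberBundle VectorField
open scoped Manifold ContDiff Topology

noncomputable section

namespace Riem

/-! Throughout, `M` is a manifold modelled on the finite-dimensional real vector space `E`, and its
tangent spaces carry inner products depending smoothly on the point. -/

variable {E : Type*} [NormedAddCommGroup E] [NormedSpace ℝ E]
  {H : Type*} [TopologicalSpace H] {I : ModelWithCorners ℝ E H}
  {M : Type*} [TopologicalSpace M] [ChartedSpace H M]

section LeviCivita

variable [RiemannianBundle (fun x : M ↦ TangentSpace I x)]

/-- The Koszul expression at `x`; it will be `2 ⟪∇_X Y, Z⟫`. Here `d% f x (X x)` is the derivative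
at `x` of the function `f` in the direction of the vector field `X`. -/
def koszul (X Y Z : Π x : M, TangentSpace I x) (x : M) : ℝ :=
  d% (fun y ↦ inner ℝ (Y y) (Z y)) x (X x)
    + d% (fun y ↦ inner ℝ (X y) (Z y)) x (Y x)
    - d% (fun y ↦ inner ℝ (X y) (Y y)) x (Z x)
    + inner ℝ (mlieBracket I X Y x) (Z x)
    - inner ℝ (mlieBracket I X Z x) (Y x)
    - inner ℝ (mlieBracket I Y Z x) (X x)

variable [IsManifold I ∞ M] [IsContMDiffRiemannianBundle I ∞ E (fun x : M ↦ TangentSpace I x)]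

theorem mdiff_inner {Y Z : Π x : M, TangentSpace I x} {x : M}
    (hY : MDiffAt (T% Y) x) (hZ : MDiffAt (T% Z) x) :
    MDiffAt (fun y ↦ inner ℝ (Y y) (Z y)) x :=
  MDifferentiableAt.inner_bundle (IB := I) (F := E) (E := fun x : M ↦ TangentSpace I x)
    (b := fun y ↦ y) hY hZ

variable [FiniteDimensional ℝ E]

theorem koszul_tensorial_left {Y Z : Π x : M, TangentSpace I x} {x : M}
    (hY : MDiffAt (T% Y) x) (hZ : MDiffAt (T% Z) x) :
    TensorialAt I E (fun X ↦ koszul X Y Z x) x where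
  smul {f X} hf hX := by
    have := FiniteDimensional.complete ℝ E
    simp [koszul, mlieBracket_smul_left hf hX, inner_smul_left, inner_smul_right, inner_add_left,
      mvfderiv_fun_mul hf (mdiff_inner hX hY), mvfderiv_fun_mul hf (mdiff_inner hX hZ)]
    rw [real_inner_comm (Y x) (X x), real_inner_comm (Z x) (X x)]
    ring
  add hX hX' := by
    have := FiniteDimensional.complete ℝ E
    simp [koszul, mlieBracket_add_left hX hX', inner_add_left, inner_add_right,
      mvfderiv_fun_add (mdiff_inner hX hY) (mdiff_inner hX' hY),
      mvfderiv_fun_add (mdiff_inner hX hZ) (mdiff_inner hX' hZ)]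
    ring

theorem koszul_tensorial_right {X Y : Π x : M, TangentSpace I x} {x : M}
    (hX : MDiffAt (T% X) x) (hY : MDiffAt (T% Y) x) :
    TensorialAt I E (fun Z ↦ koszul X Y Z x) x where
  smul {f Z} hf hZ := by
    have := FiniteDimensional.complete ℝ E
    simp [koszul, mlieBracket_smul_right hf hZ, inner_smul_left, inner_smul_right, inner_add_left,
      mvfderiv_fun_mul hf (mdiff_inner hX hZ), mvfderiv_fun_mul hf (mdiff_inner hY hZ)]
    rw [real_inner_comm (Y x) (Z x), real_inner_comm (X x) (Z x)]
    ring
  add hZ hZ' := by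
    have := FiniteDimensional.complete ℝ E
    simp [koszul, mlieBracket_add_right hZ hZ', inner_add_left, inner_add_right,
      mvfderiv_fun_add (mdiff_inner hX hZ) (mdiff_inner hX hZ'),
      mvfderiv_fun_add (mdiff_inner hY hZ) (mdiff_inner hY hZ')]
    ring

theorem koszul_add {X Y Y' Z : Π x : M, TangentSpace I x} {x : M} (hX : MDiffAt (T% X) x)
    (hY : MDiffAt (T% Y) x) (hY' : MDiffAt (T% Y') x) (hZ : MDiffAt (T% Z) x) :
    koszul X (Y + Y') Z x = koszul X Y Z x + koszul X Y' Z x := by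
  have := FiniteDimensional.complete ℝ E
  simp [koszul, mlieBracket_add_right hY hY', mlieBracket_add_left hY hY', inner_add_left,
    inner_add_right, mvfderiv_fun_add (mdiff_inner hX hY) (mdiff_inner hX hY'),
    mvfderiv_fun_add (mdiff_inner hY hZ) (mdiff_inner hY' hZ)]
  ring

theorem koszul_smul {X Y Z : Π x : M, TangentSpace I x} {f : M → ℝ} {x : M}
    (hX : MDiffAt (T% X) x) (hf : MDiffAt f x) (hY : MDiffAt (T% Y) x) (hZ : MDiffAt (T% Z) x) :
    koszul X (f • Y) Z x =
      f x * koszul X Y Z x + 2 * (d% f x (X x) * inner ℝ (Y x) (Z x)) := by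
  have := FiniteDimensional.complete ℝ E
  simp [koszul, mlieBracket_smul_right hf hY, mlieBracket_smul_left hf hY, inner_add_left,
    inner_smul_left, inner_smul_right,
    mvfderiv_fun_mul hf (mdiff_inner hX hY), mvfderiv_fun_mul hf (mdiff_inner hY hZ)]
  rw [real_inner_comm (X x) (Y x)]
  ring

/-- The bilinear form `(u, w) ↦ 2 ⟪∇_u Y, w⟫` on `T_x M`, where `Y` is differentiable at `x`. -/
def koszulForm (Y : Π x : M, TangentSpace I x) (x : M) (hY : MDiffAt (T% Y) x) :
    TangentSpace I x →L[ℝ] TangentSpace I x →L[ℝ] ℝ :=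
  TensorialAt.mkHom₂ (fun X Z ↦ koszul X Y Z x) x
    (fun _ hZ ↦ koszul_tensorial_left hY hZ) (fun _ hX ↦ koszul_tensorial_right hX hY)

instance (x : M) : FiniteDimensional ℝ (TangentSpace I x) :=
  inferInstanceAs (FiniteDimensional ℝ E)

open Classical in
/-- `u ↦ ∇_u Y` at `x`, read off from the Koszul form in an orthonormal basis of `T_x M`. -/
def leviCivitaAux (Y : Π x : M, TangentSpace I x) (x : M) :
    TangentSpace I x →L[ℝ] TangentSpace I x :=
  if hY : MDiffAt (T% Y) x then
    ∑ i, (2⁻¹ : ℝ) • ((koszulForm Y x hY).flip (stdOrthonormalBasis ℝ (TangentSpace I x) i)).smulRight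
      (stdOrthonormalBasis ℝ (TangentSpace I x) i)
  else 0

theorem inner_leviCivitaAux {X Y Z : Π x : M, TangentSpace I x} {x : M}
    (hX : MDiffAt (T% X) x) (hY : MDiffAt (T% Y) x) (hZ : MDiffAt (T% Z) x) :
    2 * inner ℝ (leviCivitaAux Y x (X x)) (Z x) = koszul X Y Z x := by
  have key : koszulForm Y x hY (X x) (Z x) = koszul X Y Z x :=
    TensorialAt.mkHom₂_apply _ _ hX hZ
  set b := stdOrthonormalBasis ℝ (TangentSpace I x) with hb
  rw [← key]
  conv_rhs => rw [← b.sum_repr' (Z x)]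
  simp only [leviCivitaAux, hY, dite_true]
  simp [sum_inner, inner_smul_left, Finset.mul_sum, ← hb]
  refine Finset.sum_congr rfl fun i _ ↦ ?_
  ring

/-- `leviCivitaAux Y x u` is characterized by the Koszul formula. -/
theorem inner_leviCivitaAux_extend {Y : Π x : M, TangentSpace I x} {x : M}
    (hY : MDiffAt (T% Y) x) (u w : TangentSpace I x) :
    2 * inner ℝ (leviCivitaAux Y x u) w = koszul (extend E u) Y (extend E w) x := by
  simpa using inner_leviCivitaAux (mdifferentiableAt_extend I E u) hY
    (mdifferentiableAt_extend I E w)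

/-- The Levi-Civita connection: `leviCivita Y x u` is `∇_u Y` at `x`. -/
def leviCivita : CovariantDerivative I E (TangentSpace I : M → Type _) where
  toFun := leviCivitaAux
  isCovariantDerivativeOnUniv :=
    { add := by
        intro Y Y' x hY hY' _
        ext u
        refine ext_inner_right ℝ fun w ↦ mul_left_cancel₀ two_ne_zero ?_
        have hu := mdifferentiableAt_extend I E u
        have hw := mdifferentiableAt_extend I E w
        rw [inner_leviCivitaAux_extend (mdifferentiableAt_add_section hY hY'),
          koszul_add hu hY hY' hw, ← inner_leviCivitaAux_extend hY,
          ← inner_leviCivitaAux_extend hY', _root_.add_apply, inner_add_left]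
        ring
      leibniz := by
        intro Y f x hY hf _
        ext u
        refine ext_inner_right ℝ fun w ↦ mul_left_cancel₀ two_ne_zero ?_
        have hu := mdifferentiableAt_extend I E u
        have hw := mdifferentiableAt_extend I E w
        rw [inner_leviCivitaAux_extend (hf.smul_section hY),
          koszul_smul hu hf hY hw, ← inner_leviCivitaAux_extend hY]
        simp [inner_add_left, inner_smul_left]
        ring }

theorem two_mul_inner_leviCivita {X Y Z : Π x : M, TangentSpace I x} {x : M}
    (hX : MDiffAt (T% X) x) (hY : MDiffAt (T% Y) x) (hZ : MDiffAt (T% Z) x) :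
    2 * inner ℝ (leviCivita Y x (X x)) (Z x) = koszul X Y Z x :=
  inner_leviCivitaAux hX hY hZ

theorem leviCivita_torsion [CompleteSpace E] :
    (leviCivita (I := I) (M := M)).torsion = 0 := by
  rw [CovariantDerivative.torsion_eq_zero_iff]
  intro X Y x hX hY
  refine ext_inner_right ℝ fun w ↦ mul_left_cancel₀ two_ne_zero ?_
  have hw := mdifferentiableAt_extend I E w
  have h1 := two_mul_inner_leviCivita hX hY hw
  have h2 := two_mul_inner_leviCivita hY hX hw
  rw [extend_apply_self] at h1 h2
  rw [inner_sub_left, mul_sub, h1, h2]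
  simp only [koszul, extend_apply_self, mlieBracket_swap_apply (V := Y) (W := X), inner_neg_left,
    real_inner_comm (X _) (Y _)]
  ring

theorem leviCivita_metric {X Y Z : Π x : M, TangentSpace I x} {x : M}
    (hX : MDiffAt (T% X) x) (hY : MDiffAt (T% Y) x) (hZ : MDiffAt (T% Z) x) :
    d% (fun y ↦ inner ℝ (Y y) (Z y)) x (X x) =
      inner ℝ (leviCivita Y x (X x)) (Z x) + inner ℝ (Y x) (leviCivita Z x (X x)) := by
  have h1 := two_mul_inner_leviCivita hX hY hZ
  have h2 := two_mul_inner_leviCivita hX hZ hY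
  refine mul_left_cancel₀ (two_ne_zero (α := ℝ)) ?_
  rw [mul_add, h1, real_inner_comm (leviCivita Z x (X x)), h2]
  simp only [koszul, mlieBracket_swap_apply (V := Z) (W := Y), inner_neg_left,
    real_inner_comm (Y _) (Z _)]
  ring

end LeviCivita

section Connection

variable [FiniteDimensional ℝ E] [IsManifold I ∞ M]

/-- The curvature `R(u, v) w = ∇_u ∇_v w - ∇_v ∇_u w - ∇_[u, v] w` at `x` of a connection on the
tangent bundle, computed on local smooth extensions of the tangent vectors `u`, `v`, `w`. -/
def curvature (cov : CovariantDerivative I E (TangentSpace I : M → Type _)) (x : M)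
    (u v w : TangentSpace I x) : TangentSpace I x :=
  cov (fun y ↦ cov (extend E w) y (extend E v y)) x u
    - cov (fun y ↦ cov (extend E w) y (extend E u y)) x v
    - cov (extend E w) x (mlieBracket I (extend E u) (extend E v) x)

/-- The velocity of a curve. -/
def velocity (γ : ℝ → M) (t : ℝ) : TangentSpace I (γ t) :=
  mfderiv 𝓘(ℝ, ℝ) I γ t (1 : ℝ)

/-- The covariant derivative `D_t V` of a vector field `V` along the curve `γ`. Write
`V = ∑ i, Vⁱ eᵢ` in the local frame `e` of the tangent bundle given by its trivialization around
`γ t`. Then `D_t V = ∑ i, (Vⁱ)' eᵢ + ∇_γ' (∑ i, Vⁱ(t) eᵢ)`; the vector field `∑ i, Vⁱ(t) eᵢ`, with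
coefficients frozen at `t`, is `extend E (V t)`. -/
def covDerivAlong (cov : CovariantDerivative I E (TangentSpace I : M → Type _)) (γ : ℝ → M)
    (V : Π t : ℝ, TangentSpace I (γ t)) (t : ℝ) : TangentSpace I (γ t) :=
  (trivializationAt E (TangentSpace I) (γ t)).symm (γ t)
      (deriv (fun s ↦ (trivializationAt E (TangentSpace I) (γ t) ⟨γ s, V s⟩).2) t)
    + cov (extend E (V t)) (γ t) (velocity γ t)

end Connection

section Riemannian

variable [FiniteDimensional ℝ E] [IsManifold I ∞ M]
  [RiemannianBundle (fun x : M ↦ TangentSpace I x)]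
  [IsContMDiffRiemannianBundle I ∞ E (fun x : M ↦ TangentSpace I x)]

variable (I) in
/-- The smooth curve `γ`, defined on the open interval `s`, is a geodesic: `D_t γ' = 0`. -/
structure IsGeodesicOn (γ : ℝ → M) (s : Set ℝ) : Prop where
  isOpen : IsOpen s
  ordConnected : s.OrdConnected
  contMDiffOn : ContMDiffOn 𝓘(ℝ, ℝ) I ∞ γ s
  eq_zero : ∀ t ∈ s, covDerivAlong leviCivita γ (velocity (I := I) γ) t = 0

/-- `J` satisfies the Jacobi equation `D_t D_t J + R(J, γ') γ' = 0` along the curve `γ`, at all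
times in `s`. -/
def IsJacobiOn (γ : ℝ → M) (J : Π t : ℝ, TangentSpace I (γ t)) (s : Set ℝ) : Prop :=
  ∀ t ∈ s, covDerivAlong leviCivita γ (covDerivAlong leviCivita γ J) t
    + curvature leviCivita (γ t) (J t) (velocity γ t) (velocity γ t) = 0

/-- A vector field is a global Jacobi field if its restriction to every geodesic is a Jacobi
field. -/
def IsGlobalJacobi (X : Π x : M, TangentSpace I x) : Prop :=
  ∀ (γ : ℝ → M) (s : Set ℝ), IsGeodesicOn I γ s → IsJacobiOn γ (fun t ↦ X (γ t)) s

/-- The divergence of a vector field: the trace of `u ↦ ∇_u X`. -/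
def divergence (X : Π x : M, TangentSpace I x) (x : M) : ℝ :=
  LinearMap.trace ℝ (TangentSpace I x) (leviCivita X x).toLinearMap

end Riemannian

end Riem

end

/-! The Jacobi equation along the geodesic through `p` with velocity `v` reads, at `p`,
`∇²_{v,v} X + R(X, v) v = 0`, because the restriction of `X` has covariant derivative
`∇_{γ'} X` along `γ` and `γ'` is parallel. Geodesics exist in all directions, so this holds for all
`v`. Polarizing in `v` and eliminating the antisymmetric part of `∇² X` with the Ricci identity
`∇²_{u,v} X - ∇²_{v,u} X = R(u, v) X` and the first Bianchi identity leaves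
`∇²_{u,v} X = - R(X, u) v` (`IsMetricOn.secondCovDiff_eq_neg_riemann`). The trace over `v` of the
left hand side is the derivative of `div X` in the direction `u`, since commutators have no trace;
the trace of the right hand side vanishes, since `R(X, u)` is skew-symmetric. So all derivatives of
`div X` are zero, and `div X` is constant on a connected manifold.

Everything is computed in the chart at a point `p`. The tensor calculus takes place for a metric `g`
on an open set of `E`, with Christoffel symbols defined by the Koszul formula. The bridge to the
manifold is `coordMap_leviCivita`, which reads the Levi-Civita connection in the chart as
`∂_v X + Γ(v, X)`, and `coordMap_covDerivAlong`, which does the same for the covariant derivative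
along a curve; the latter is defined through the chart at the current point of the curve, and its
independence of the chart follows from the Leibniz rule `covDerivAlong_sum_smul`. Geodesics come
from the Picard-Lindelöf theorem applied to `c'' = - Γ(c)(c', c')` (`exists_geodesic_equation`). -/

noncomputable section

-- The default depth is too small to find the normed space structure of spaces of trilinear maps.
set_option maxSynthPendingDepth 3
set_option synthInstance.maxHeartbeats 200000

namespace Riem

/-! ### Tensor calculus for a metric on an open subset of a vector space -/

section Coordinates

variable {E : Type*} [NormedAddCommGroup E] [NormedSpace ℝ E]

/-- `g` is a smooth Riemannian metric on the open subset `U` of `E`. -/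
structure IsMetricOn (g : E → E →L[ℝ] E →L[ℝ] ℝ) (U : Set E) : Prop where
  isOpen : IsOpen U
  contDiffOn : ContDiffOn ℝ ∞ g U
  symm : ∀ x ∈ U, ∀ v w, g x v w = g x w v
  pos : ∀ x ∈ U, ∀ v, v ≠ 0 → 0 < g x v v

/-- The Christoffel symbols of the first kind, as a trilinear form:
`½ (∂_u g(v, w) + ∂_v g(u, w) - ∂_w g(u, v))`. -/
def christoffelLower (g : E → E →L[ℝ] E →L[ℝ] ℝ) (x : E) : E →L[ℝ] E →L[ℝ] E →L[ℝ] ℝ :=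
  (2⁻¹ : ℝ) • (fderiv ℝ g x + (fderiv ℝ g x).flip
    - (ContinuousLinearMap.flipₗᵢ ℝ E E ℝ).toContinuousLinearEquiv.toContinuousLinearMap.comp
        (fderiv ℝ g x).flip)

/-- The Christoffel symbols `Γ x u v` of the metric `g`, obtained by raising the last index of
`christoffelLower`. -/
def christoffel (g : E → E →L[ℝ] E →L[ℝ] ℝ) (x : E) : E →L[ℝ] E →L[ℝ] E :=
  (ContinuousLinearMap.compL ℝ E (E →L[ℝ] ℝ) E (g x).inverse).comp (christoffelLower g x)

/-- The curvature in coordinates of the connection with Christoffel symbols `Γ`. -/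
def riemann (Γ : E → E →L[ℝ] E →L[ℝ] E) (x u v w : E) : E :=
  fderiv ℝ Γ x u v w - fderiv ℝ Γ x v u w + Γ x u (Γ x v w) - Γ x v (Γ x u w)

/-- The covariant differential `v ↦ ∇_v ξ` in coordinates. -/
def covDiff (Γ : E → E →L[ℝ] E →L[ℝ] E) (ξ : E → E) (x : E) : E →L[ℝ] E :=
  fderiv ℝ ξ x + (Γ x).flip (ξ x)

/-- The second covariant derivative `∇²_{u,v} ξ` in coordinates. -/
def secondCovDiff (Γ : E → E →L[ℝ] E →L[ℝ] E) (ξ : E → E) (x u v : E) : E :=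
  fderiv ℝ (covDiff Γ ξ) x u v + Γ x u (covDiff Γ ξ x v) - covDiff Γ ξ x (Γ x u v)

theorem christoffelLower_apply (g : E → E →L[ℝ] E →L[ℝ] ℝ) (x u v w : E) :
    christoffelLower g x u v w =
      2⁻¹ * (fderiv ℝ g x u v w + fderiv ℝ g x v u w - fderiv ℝ g x w u v) := by
  simp [christoffelLower]

namespace IsMetricOn

variable {g : E → E →L[ℝ] E →L[ℝ] ℝ} {U : Set E} (hg : IsMetricOn g U)
include hg

theorem contDiffAt {x : E} (hx : x ∈ U) : ContDiffAt ℝ ∞ g x :=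
  hg.contDiffOn.contDiffAt (hg.isOpen.mem_nhds hx)

theorem differentiableAt {x : E} (hx : x ∈ U) : DifferentiableAt ℝ g x :=
  (hg.contDiffAt hx).differentiableAt (by simp)

theorem eq_of_forall {x : E} (hx : x ∈ U) {v v' : E} (h : ∀ w, g x v w = g x v' w) : v = v' := by
  by_contra hne
  have := hg.pos x hx (v - v') (sub_ne_zero.2 hne)
  simp [h] at this

/-- The derivative of the metric is symmetric in the arguments of the metric. -/
theorem fderiv_symm {x : E} (hx : x ∈ U) (u v w : E) :
    fderiv ℝ g x u v w = fderiv ℝ g x u w v := by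
  have h := (hg.differentiableAt hx).hasFDerivAt
  have h1 : HasFDerivAt (fun y ↦ g y v w) (((fderiv ℝ g x).flip v).flip w) x := by
    simpa using (h.clm_apply (hasFDerivAt_const v x)).clm_apply (hasFDerivAt_const w x)
  have h2 : HasFDerivAt (fun y ↦ g y w v) (((fderiv ℝ g x).flip w).flip v) x := by
    simpa using (h.clm_apply (hasFDerivAt_const w x)).clm_apply (hasFDerivAt_const v x)
  have h3 : (fun y ↦ g y v w) =ᶠ[𝓝 x] fun y ↦ g y w v := by
    filter_upwards [hg.isOpen.mem_nhds hx] with y hy using hg.symm y hy v w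
  exact DFunLike.congr_fun (h1.unique (h2.congr_of_eventuallyEq h3)) u

variable [FiniteDimensional ℝ E]

theorem isInvertible {x : E} (hx : x ∈ U) : (g x).IsInvertible := by
  have hinj : Function.Injective (g x : E →ₗ[ℝ] E →L[ℝ] ℝ) := fun v v' h ↦
    hg.eq_of_forall hx fun w ↦ DFunLike.congr_fun h w
  have hdim : Module.finrank ℝ E = Module.finrank ℝ (E →L[ℝ] ℝ) := by
    rw [← (LinearMap.toContinuousLinearMap (𝕜 := ℝ) (E := E) (F' := ℝ)).finrank_eq]
    exact (Subspace.dual_finrank_eq (K := ℝ) (V := E)).symm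
  refine ⟨(LinearMap.linearEquivOfInjective _ hinj hdim).toContinuousLinearEquiv, ?_⟩
  ext v w
  rfl

theorem apply_christoffel {x : E} (hx : x ∈ U) (u v w : E) :
    g x (christoffel g x u v) w = christoffelLower g x u v w := by
  obtain ⟨e, he⟩ := hg.isInvertible hx
  have : christoffel g x u v = e.symm (christoffelLower g x u v) := by
    simp [christoffel, ← he]
  rw [this, ← he]
  simp

theorem christoffel_symm {x : E} (hx : x ∈ U) (u v : E) :
    christoffel g x u v = christoffel g x v u := by
  refine hg.eq_of_forall hx fun w ↦ ?_
  rw [hg.apply_christoffel hx, hg.apply_christoffel hx, christoffelLower_apply,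
    christoffelLower_apply, hg.fderiv_symm hx w u v]
  ring

/-- The connection with Christoffel symbols `christoffel g` is compatible with `g`. -/
theorem fderiv_eq {x : E} (hx : x ∈ U) (u v w : E) :
    fderiv ℝ g x u v w = g x (christoffel g x u v) w + g x v (christoffel g x u w) := by
  rw [hg.symm x hx v, hg.apply_christoffel hx, hg.apply_christoffel hx, christoffelLower_apply,
    christoffelLower_apply, hg.fderiv_symm hx u w v]
  ring

theorem contDiffOn_christoffel : ContDiffOn ℝ ∞ (christoffel g) U := by
  have := FiniteDimensional.complete ℝ E
  intro x hx
  refine ContDiffAt.contDiffWithinAt ?_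
  obtain ⟨e, he⟩ := hg.isInvertible hx
  have hD : ContDiffAt ℝ ∞ (fderiv ℝ g) x := (hg.contDiffAt hx).fderiv_right (by simp)
  -- `ContinuousLinearMap.inverse` is smooth at invertible maps, and `g x` is invertible.
  have hinv : ContDiffAt ℝ ∞ (fun y ↦ (g y).inverse) x := by
    refine ContDiffAt.comp x (g := ContinuousLinearMap.inverse) ?_ (hg.contDiffAt hx)
    rw [← he]
    exact contDiffAt_map_inverse e
  have hflip : ContDiffAt ℝ ∞ (fun y ↦ (fderiv ℝ g y).flip) x :=
    (ContinuousLinearMap.flipₗᵢ ℝ E E (E →L[ℝ] ℝ)).contDiff.contDiffAt.comp x hD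
  have hlow : ContDiffAt ℝ ∞ (christoffelLower g) x :=
    ((hD.add hflip).sub (contDiffAt_const.clm_comp hflip)).const_smul _
  exact ((ContinuousLinearMap.compL ℝ E (E →L[ℝ] ℝ) E).contDiff.contDiffAt.comp x hinv).clm_comp
    hlow

theorem christoffel_differentiableAt {x : E} (hx : x ∈ U) :
    DifferentiableAt ℝ (christoffel g) x :=
  (hg.contDiffOn_christoffel.contDiffAt (hg.isOpen.mem_nhds hx)).differentiableAt (by simp)

theorem fderiv_christoffel_symm {x : E} (hx : x ∈ U) (u v w : E) :
    fderiv ℝ (christoffel g) x u v w = fderiv ℝ (christoffel g) x u w v := by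
  have h := (hg.christoffel_differentiableAt hx).hasFDerivAt
  have h1 : HasFDerivAt (fun y ↦ christoffel g y v w)
      (((fderiv ℝ (christoffel g) x).flip v).flip w) x := by
    simpa using (h.clm_apply (hasFDerivAt_const v x)).clm_apply (hasFDerivAt_const w x)
  have h2 : HasFDerivAt (fun y ↦ christoffel g y w v)
      (((fderiv ℝ (christoffel g) x).flip w).flip v) x := by
    simpa using (h.clm_apply (hasFDerivAt_const w x)).clm_apply (hasFDerivAt_const v x)
  have h3 : (fun y ↦ christoffel g y v w) =ᶠ[𝓝 x] fun y ↦ christoffel g y w v := by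
    filter_upwards [hg.isOpen.mem_nhds hx] with y hy using hg.christoffel_symm hy v w
  exact DFunLike.congr_fun (h1.unique (h2.congr_of_eventuallyEq h3)) u

/-- The first Bianchi identity. -/
theorem riemann_cyclic {x : E} (hx : x ∈ U) (u v w : E) :
    riemann (christoffel g) x u v w + riemann (christoffel g) x v w u
      + riemann (christoffel g) x w u v = 0 := by
  simp only [riemann]
  rw [hg.fderiv_christoffel_symm hx v w u, hg.fderiv_christoffel_symm hx u v w,
    hg.fderiv_christoffel_symm hx w u v, hg.christoffel_symm hx w u,
    hg.christoffel_symm hx v w, hg.christoffel_symm hx u v]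
  abel

/-- `R(u, v)` is skew-symmetric with respect to `g`, since the second derivatives of `g`
commute. -/
theorem apply_riemann_self {x : E} (hx : x ∈ U) (u v w : E) :
    g x (riemann (christoffel g) x u v w) w = 0 := by
  set Γ := christoffel g
  have hΓ := (hg.christoffel_differentiableAt hx).hasFDerivAt
  have hg' := (hg.differentiableAt hx).hasFDerivAt
  have hsymm : IsSymmSndFDerivAt ℝ g x := (hg.contDiffAt hx).isSymmSndFDerivAt
    (by simpa only [minSmoothness_of_isRCLikeNormedField] using ENat.LEInfty.out)
  have hD : DifferentiableAt ℝ (fderiv ℝ g) x :=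
    ((hg.contDiffAt hx).fderiv_right (m := 1) (one_add_one_eq_two.trans_le
      ENat.LEInfty.out)).differentiableAt (by simp)
  have key (v u : E) : fderiv ℝ (fderiv ℝ g) x u v w w =
      2 * (g x (Γ x u (Γ x v w)) w + g x (Γ x v w) (Γ x u w)
        + g x (fderiv ℝ Γ x u v w) w) := by
    have h1 : HasFDerivAt (fun y ↦ fderiv ℝ g y v w w)
        ((((fderiv ℝ (fderiv ℝ g) x).flip v).flip w).flip w) x := by
      simpa using ((hD.hasFDerivAt.clm_apply (hasFDerivAt_const v x)).clm_apply
        (hasFDerivAt_const w x)).clm_apply (hasFDerivAt_const w x)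
    have h2 : (fun y ↦ fderiv ℝ g y v w w) =ᶠ[𝓝 x] fun y ↦ 2 * g y (Γ y v w) w := by
      filter_upwards [hg.isOpen.mem_nhds hx] with y hy
      rw [hg.fderiv_eq hy, hg.symm y hy w]
      ring
    have h3 := ((hg'.clm_apply ((hΓ.clm_apply (hasFDerivAt_const v x)).clm_apply
      (hasFDerivAt_const w x))).clm_apply (hasFDerivAt_const w x)).const_mul 2
    have h4 := DFunLike.congr_fun (h1.unique (h3.congr_of_eventuallyEq h2)) u
    simp at h4
    rw [h4, hg.fderiv_eq hx]
    ring
  have h := hsymm.eq u v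
  have h' : fderiv ℝ (fderiv ℝ g) x u v w w = fderiv ℝ (fderiv ℝ g) x v u w w := by rw [h]
  rw [key, key, hg.symm x hx (Γ x v w)] at h'
  simp only [riemann, map_add, map_sub, _root_.add_apply, _root_.sub_apply]
  linarith

/-- An endomorphism that is skew-symmetric with respect to an inner product has trace zero. -/
theorem trace_eq_zero {x : E} (hx : x ∈ U) (T : E →ₗ[ℝ] E)
    (hT : ∀ w, g x (T w) w = 0) : LinearMap.trace ℝ E T = 0 := by
  have hskew (v w : E) : g x (T v) w = - g x v (T w) := by
    have h := hT (v + w)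
    simp only [map_add, _root_.add_apply, hT] at h
    rw [hg.symm x hx v]
    linarith
  obtain ⟨e, he⟩ := hg.isInvertible hx
  let f : E ≃ₗ[ℝ] Module.Dual ℝ E := e.toLinearEquiv.trans LinearMap.toContinuousLinearMap.symm
  have hf (v w : E) : f v w = g x v w := by rw [← he]; rfl
  -- `g` conjugates `T` to the negative of its transpose, so `tr T = - tr T`.
  have hconj : f.conj T = - Module.Dual.transpose (R := ℝ) T := by
    ext φ w
    obtain ⟨v, rfl⟩ := f.surjective φ
    simp [LinearEquiv.conj_apply, hf, hskew, Module.Dual.transpose_apply]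
  have h1 := LinearMap.trace_conj' T f
  rw [hconj, _root_.map_neg, LinearMap.trace_transpose'] at h1
  linarith

variable {ξ : E → E} {x : E}

theorem differentiableAt_covDiff (hx : x ∈ U) (hξ : ContDiffAt ℝ ∞ ξ x) :
    DifferentiableAt ℝ (covDiff (christoffel g) ξ) x := by
  have hD : DifferentiableAt ℝ (fderiv ℝ ξ) x :=
    (hξ.fderiv_right (m := 1) (one_add_one_eq_two.trans_le
      ENat.LEInfty.out)).differentiableAt (by simp)
  have hflip : DifferentiableAt ℝ (fun y ↦ (christoffel g y).flip) x :=
    (ContinuousLinearMap.flipₗᵢ ℝ E E E).differentiableAt.comp x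
      (hg.christoffel_differentiableAt hx)
  exact hD.add (hflip.clm_apply (hξ.differentiableAt (by simp)))

theorem hasDerivAt_covDiff_deriv {c : ℝ → E} {t : ℝ} {w : E} (hx : c t ∈ U)
    (hξ : ContDiffAt ℝ ∞ ξ (c t)) (hc : DifferentiableAt ℝ c t) (hc' : HasDerivAt (deriv c) w t) :
    HasDerivAt (fun s ↦ covDiff (christoffel g) ξ (c s) (deriv c s))
      (fderiv ℝ (covDiff (christoffel g) ξ) (c t) (deriv c t) (deriv c t)
        + covDiff (christoffel g) ξ (c t) w) t := by
  have h : HasDerivAt (fun s ↦ covDiff (christoffel g) ξ (c s))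
      (fderiv ℝ (covDiff (christoffel g) ξ) (c t) (deriv c t)) t :=
    (hg.differentiableAt_covDiff hx hξ).hasFDerivAt.comp_hasDerivAt t hc.hasDerivAt
  exact h.clm_apply hc'

theorem fderiv_covDiff (hx : x ∈ U) (hξ : ContDiffAt ℝ ∞ ξ x) (u v : E) :
    fderiv ℝ (covDiff (christoffel g) ξ) x u v =
      fderiv ℝ (fderiv ℝ ξ) x u v + fderiv ℝ (christoffel g) x u v (ξ x)
        + christoffel g x v (fderiv ℝ ξ x u) := by
  have hD : DifferentiableAt ℝ (fderiv ℝ ξ) x :=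
    (hξ.fderiv_right (m := 1) (one_add_one_eq_two.trans_le
      ENat.LEInfty.out)).differentiableAt (by simp)
  have hΓ := (hg.christoffel_differentiableAt hx).hasFDerivAt
  have h1 := (hg.differentiableAt_covDiff hx hξ).hasFDerivAt.clm_apply (hasFDerivAt_const v x)
  have h2 : HasFDerivAt (fun y ↦ covDiff (christoffel g) ξ y v) _ x :=
    (hD.hasFDerivAt.clm_apply (hasFDerivAt_const v x)).add
      ((hΓ.clm_apply (hasFDerivAt_const v x)).clm_apply
        (hξ.differentiableAt (by simp)).hasFDerivAt)
  have h3 := DFunLike.congr_fun (h1.unique h2) u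
  simp at h3
  rw [h3]
  abel

/-- The Ricci identity. -/
theorem secondCovDiff_sub (hx : x ∈ U) (hξ : ContDiffAt ℝ ∞ ξ x) (u v : E) :
    secondCovDiff (christoffel g) ξ x u v - secondCovDiff (christoffel g) ξ x v u =
      riemann (christoffel g) x u v (ξ x) := by
  have hsymm : fderiv ℝ (fderiv ℝ ξ) x u v = fderiv ℝ (fderiv ℝ ξ) x v u :=
    (hξ.isSymmSndFDerivAt
    (by simpa only [minSmoothness_of_isRCLikeNormedField] using ENat.LEInfty.out)).eq u v
  simp only [secondCovDiff, hg.fderiv_covDiff hx hξ, riemann, hsymm, hg.christoffel_symm hx v u]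
  simp only [covDiff, _root_.add_apply, ContinuousLinearMap.flip_apply, map_add]
  abel

/-- The Jacobi equation along all geodesics determines the whole second covariant derivative, by
polarization, the Ricci identity and the Bianchi identity. -/
theorem secondCovDiff_eq_neg_riemann (hx : x ∈ U) (hξ : ContDiffAt ℝ ∞ ξ x)
    (h : ∀ v, secondCovDiff (christoffel g) ξ x v v + riemann (christoffel g) x (ξ x) v v = 0)
    (u v : E) :
    secondCovDiff (christoffel g) ξ x u v = - riemann (christoffel g) x (ξ x) u v := by
  have hricci := hg.secondCovDiff_sub hx hξ u v
  have hcyc := hg.riemann_cyclic hx u v (ξ x)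
  have hswap : riemann (christoffel g) x v (ξ x) u = - riemann (christoffel g) x (ξ x) v u := by
    simp only [riemann]; abel
  have hpol : secondCovDiff (christoffel g) ξ x u v + secondCovDiff (christoffel g) ξ x v u
      + riemann (christoffel g) x (ξ x) u v + riemann (christoffel g) x (ξ x) v u = 0 := by
    have h1 : secondCovDiff (christoffel g) ξ x (u + v) (u + v) =
        secondCovDiff (christoffel g) ξ x u u + secondCovDiff (christoffel g) ξ x u v +
        secondCovDiff (christoffel g) ξ x v u + secondCovDiff (christoffel g) ξ x v v := by
      simp only [secondCovDiff, map_add, _root_.add_apply]; abel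
    have h2 : riemann (christoffel g) x (ξ x) (u + v) (u + v) =
        riemann (christoffel g) x (ξ x) u u + riemann (christoffel g) x (ξ x) u v +
        riemann (christoffel g) x (ξ x) v u + riemann (christoffel g) x (ξ x) v v := by
      simp only [riemann, map_add, _root_.add_apply]; abel
    have h3 := h (u + v)
    rw [h1, h2] at h3
    linear_combination (norm := abel) h3 - h u - h v
  rw [hswap] at hcyc
  refine smul_right_injective E (two_ne_zero (α := ℝ)) ?_
  simp only [two_smul]
  linear_combination (norm := abel) hpol + hricci + hcyc

/-- In coordinates: the divergence of a field satisfying the Jacobi equation along all geodesics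
through `x` is critical at `x`. -/
theorem hasFDerivAt_trace_covDiff (hx : x ∈ U) (hξ : ContDiffAt ℝ ∞ ξ x)
    (h : ∀ v, secondCovDiff (christoffel g) ξ x v v + riemann (christoffel g) x (ξ x) v v = 0) :
    HasFDerivAt (fun y ↦ LinearMap.trace ℝ E (covDiff (christoffel g) ξ y).toLinearMap)
      (0 : E →L[ℝ] ℝ) x := by
  let tr : (E →L[ℝ] E) →L[ℝ] ℝ :=
    ((LinearMap.trace ℝ E).comp (ContinuousLinearMap.coeLM ℝ)).toContinuousLinearMap
  have h1 : HasFDerivAt (fun y ↦ tr (covDiff (christoffel g) ξ y))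
      (tr.comp (fderiv ℝ (covDiff (christoffel g) ξ) x)) x :=
    tr.hasFDerivAt.comp x (hg.differentiableAt_covDiff hx hξ).hasFDerivAt
  convert! h1 using 1
  ext u
  set A := covDiff (christoffel g) ξ x
  set B := fderiv ℝ (covDiff (christoffel g) ξ) x u
  set G := christoffel g x u
  -- The commutator `G A - A G` is included so that this endomorphism is `secondCovDiff u`.
  have hskew := hg.trace_eq_zero hx
    ((B : E →ₗ[ℝ] E) + (G : E →ₗ[ℝ] E) * (A : E →ₗ[ℝ] E) - (A : E →ₗ[ℝ] E) * (G : E →ₗ[ℝ] E))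
    (fun w ↦ by
      have h2 := hg.secondCovDiff_eq_neg_riemann hx hξ h u w
      have h3 := hg.apply_riemann_self hx (ξ x) u w
      have h4 : ((B : E →ₗ[ℝ] E) + (G : E →ₗ[ℝ] E) * (A : E →ₗ[ℝ] E)
          - (A : E →ₗ[ℝ] E) * (G : E →ₗ[ℝ] E)) w = secondCovDiff (christoffel g) ξ x u w := rfl
      rw [h4, h2, map_neg, _root_.neg_apply, h3, neg_zero])
  rw [_root_.map_sub, _root_.map_add, LinearMap.trace_mul_comm, add_sub_cancel_right] at hskew
  exact hskew.symm

end IsMetricOn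

end Coordinates

/-! ### Solutions of the geodesic equation -/

section GeodesicEquation

variable {E : Type*} [NormedAddCommGroup E] [NormedSpace ℝ E] [CompleteSpace E]

/-- Through every point there is, in every direction, a smooth solution of the geodesic equation. -/
theorem exists_geodesic_equation {Γ : E → E →L[ℝ] E →L[ℝ] E} {U : Set E} (hU : IsOpen U)
    (hΓ : ContDiffOn ℝ ∞ Γ U) {x : E} (hx : x ∈ U) (v : E) :
    ∃ (c : ℝ → E) (ε : ℝ), 0 < ε ∧ ContDiffOn ℝ ∞ c (Set.Ioo (-ε) ε) ∧
      (∀ s ∈ Set.Ioo (-ε) ε, c s ∈ U) ∧ c 0 = x ∧ deriv c 0 = v ∧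
      ∀ s ∈ Set.Ioo (-ε) ε, deriv (deriv c) s = - Γ (c s) (deriv c s) (deriv c s) := by
  let F : E × E → E × E := fun z ↦ (z.2, - Γ z.1 z.2 z.2)
  have hUU : IsOpen (U ×ˢ (Set.univ : Set E)) := hU.prod isOpen_univ
  have hF : ContDiffOn ℝ ∞ F (U ×ˢ Set.univ) :=
    contDiffOn_snd.prodMk (((hΓ.comp contDiffOn_fst fun z hz ↦ hz.1).clm_apply
      contDiffOn_snd).clm_apply contDiffOn_snd).neg
  have hxv : (x, v) ∈ U ×ˢ (Set.univ : Set E) := ⟨hx, trivial⟩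
  obtain ⟨α, hα0, ε, hε, hα⟩ :=
    ContDiffAt.exists_forall_mem_closedBall_exists_eq_forall_mem_Ioo_hasDerivAt₀
      (((hF.contDiffAt (hUU.mem_nhds hxv))).of_le ENat.LEInfty.out) 0
  simp only [zero_sub, zero_add] at hα
  have hcont : ContinuousAt α 0 := (hα 0 ⟨by linarith, hε⟩).continuousAt
  obtain ⟨δ, hδ, hball⟩ := Metric.mem_nhds_iff.1 (hcont (hUU.mem_nhds (by rwa [hα0])))
  -- A compact time interval inside the domain, as the regularity theorem for solutions requires.
  set r := min ε δ / 2
  have hr : 0 < r := half_pos (lt_min hε hδ)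
  have hrε : r < ε := (half_lt_self (lt_min hε hδ)).trans_le (min_le_left _ _)
  have hrδ : r < δ := (half_lt_self (lt_min hε hδ)).trans_le (min_le_right _ _)
  have hα' (s) (hs : s ∈ Set.Icc (-r) r) : HasDerivAt α (F (α s)) s :=
    hα s ⟨by linarith [hs.1], by linarith [hs.2]⟩
  have hmem (s) (hs : s ∈ Set.Icc (-r) r) : α s ∈ U ×ˢ (Set.univ : Set E) := by
    refine hball ?_
    rw [mem_ball_zero_iff, Real.norm_eq_abs]
    exact (abs_le.2 hs).trans_lt hrδ
  have hsmooth : ContDiffOn ℝ ∞ α (Set.Icc (-r) r) :=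
    ODE.contDiffOn_enat_Icc_of_hasDerivWithinAt (f := fun _ ↦ F) (u := U ×ˢ Set.univ)
      (hF.comp contDiffOn_snd fun z hz ↦ hz.2) (fun s hs ↦ (hα' s hs).hasDerivWithinAt) hmem
  have hc (s) (hs : s ∈ Set.Icc (-r) r) : HasDerivAt (fun s ↦ (α s).1) (α s).2 s :=
    (hα' s hs).fst
  have h0 : (0 : ℝ) ∈ Set.Icc (-r) r := ⟨by linarith, hr.le⟩
  refine ⟨fun s ↦ (α s).1, r, hr, (hsmooth.mono Set.Ioo_subset_Icc_self).fst,
    fun s hs ↦ (hmem s (Set.Ioo_subset_Icc_self hs)).1, by simp [hα0],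
    by simp [(hc 0 h0).deriv, hα0], fun s hs ↦ ?_⟩
  have hev : deriv (fun s ↦ (α s).1) =ᶠ[𝓝 s] fun s ↦ (α s).2 := by
    filter_upwards [isOpen_Ioo.mem_nhds hs] with s' hs'
    exact (hc s' (Set.Ioo_subset_Icc_self hs')).deriv
  have hsnd : HasDerivAt (fun s ↦ (α s).2) (F (α s)).2 s :=
    (hα' s (Set.Ioo_subset_Icc_self hs)).snd
  rw [hev.deriv_eq, hev.self_of_nhds, hsnd.deriv]

end GeodesicEquation

/-! ### Coordinate vector fields and components in a chart -/

section Chart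

variable {E : Type*} [NormedAddCommGroup E] [NormedSpace ℝ E]
  {M : Type*} [TopologicalSpace M] [ChartedSpace E M]

section

variable {p y : M}

theorem isOpen_target (p : M) : IsOpen (extChartAt 𝓘(ℝ, E) p).target :=
  isOpen_extChartAt_target p

theorem symm_mem {x : E} (hx : x ∈ (extChartAt 𝓘(ℝ, E) p).target) :
    (extChartAt 𝓘(ℝ, E) p).symm x ∈ (chartAt E p).source := by
  rw [← extChartAt_source 𝓘(ℝ, E)]
  exact (extChartAt 𝓘(ℝ, E) p).map_target hx

theorem chart_mem (hy : y ∈ (chartAt E p).source) :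
    extChartAt 𝓘(ℝ, E) p y ∈ (extChartAt 𝓘(ℝ, E) p).target :=
  (extChartAt 𝓘(ℝ, E) p).map_source (by rwa [extChartAt_source])

theorem symm_chart (hy : y ∈ (chartAt E p).source) :
    (extChartAt 𝓘(ℝ, E) p).symm (extChartAt 𝓘(ℝ, E) p y) = y :=
  (extChartAt 𝓘(ℝ, E) p).left_inv (by rwa [extChartAt_source])

end

variable [IsManifold 𝓘(ℝ, E) ∞ M]

/-- The coordinate vector field of the chart at `p` with constant components `w`. Outside the domain
of the chart it is zero. -/
def coordField (p : M) (w : E) (y : M) : TangentSpace 𝓘(ℝ, E) y :=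
  (trivializationAt E (TangentSpace 𝓘(ℝ, E)) p).symm y w

/-- The components of tangent vectors at `y` in the chart at `p`. -/
def coordMap (p y : M) : TangentSpace 𝓘(ℝ, E) y →L[ℝ] E :=
  (trivializationAt E (TangentSpace 𝓘(ℝ, E)) p).continuousLinearMapAt ℝ y

/-- The components of the vector field `X` in the chart at `p`, as a function on `E`. -/
def fieldRep (p : M) (X : Π y : M, TangentSpace 𝓘(ℝ, E) y) (x : E) : E :=
  coordMap p ((extChartAt 𝓘(ℝ, E) p).symm x) (X ((extChartAt 𝓘(ℝ, E) p).symm x))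

variable {p y : M}

/-- `extend`, which the definitions of the covariant derivative along a curve and of the curvature
rely on, produces coordinate vector fields. -/
theorem extend_eq_coordField (v : TangentSpace 𝓘(ℝ, E) p) :
    extend E v = coordField p (coordMap p p v) := by
  have hp : p ∈ (trivializationAt E (TangentSpace 𝓘(ℝ, E)) p).baseSet :=
    mem_baseSet_trivializationAt' p
  funext y
  simp only [extend, coordField, coordMap, Trivialization.continuousLinearMapAt_apply,
    Trivialization.coe_linearMapAt_of_mem _ hp]

theorem coordMap_apply (hy : y ∈ (chartAt E p).source) (v : TangentSpace 𝓘(ℝ, E) y) :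
    coordMap p y v = (trivializationAt E (TangentSpace 𝓘(ℝ, E)) p ⟨y, v⟩).2 := by
  have hy' : y ∈ (trivializationAt E (TangentSpace 𝓘(ℝ, E)) p).baseSet := hy
  simp only [coordMap, Trivialization.continuousLinearMapAt_apply,
    Trivialization.coe_linearMapAt_of_mem _ hy']

theorem coordField_eq_symmL (hy : y ∈ (chartAt E p).source) (w : E) :
    coordField p w y = (trivializationAt E (TangentSpace 𝓘(ℝ, E)) p).symmL ℝ y w :=
  (Trivialization.symmL_apply _ (by exact hy) w).symm

theorem coordMap_coordField (hy : y ∈ (chartAt E p).source) (w : E) :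
    coordMap p y (coordField p w y) = w := by
  rw [coordField_eq_symmL hy]
  exact Trivialization.continuousLinearMapAt_symmL (R := ℝ)
    (trivializationAt E (TangentSpace 𝓘(ℝ, E)) p) hy w

theorem coordField_coordMap (hy : y ∈ (chartAt E p).source) (v : TangentSpace 𝓘(ℝ, E) y) :
    coordField p (coordMap p y v) y = v := by
  rw [coordField_eq_symmL hy]
  exact Trivialization.symmL_continuousLinearMapAt _ (by exact hy) v

theorem coordMap_injective (hy : y ∈ (chartAt E p).source) :
    Function.Injective (coordMap (E := E) p y) :=
  Function.LeftInverse.injective (g := fun w ↦ coordField p w y)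
    fun v ↦ coordField_coordMap hy v

theorem mfderiv_extChartAt (hy : y ∈ (chartAt E p).source) :
    mfderiv 𝓘(ℝ, E) 𝓘(ℝ, E) (extChartAt 𝓘(ℝ, E) p) y = coordMap p y :=
  (TangentBundle.continuousLinearMapAt_trivializationAt hy).symm

theorem contMDiffAt_coordField (hy : y ∈ (chartAt E p).source) (w : E) :
    CMDiffAt ∞ (T% (coordField p w)) y := by
  refine (Trivialization.contMDiffAt_section_iff
    (trivializationAt E (TangentSpace 𝓘(ℝ, E)) p) (by exact hy)).2 ?_
  refine (contMDiffAt_const (c := w)).congr_of_eventuallyEq ?_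
  filter_upwards [(chartAt E p).open_source.mem_nhds hy] with z hz
  rw [← coordMap_apply hz, coordMap_coordField hz]

theorem mdifferentiableAt_coordField (hy : y ∈ (chartAt E p).source) (w : E) :
    MDiffAt (T% (coordField p w)) y :=
  (contMDiffAt_coordField hy w).mdifferentiableAt (by simp)

theorem contMDiffAt_symm {x : E} (hx : x ∈ (extChartAt 𝓘(ℝ, E) p).target) :
    ContMDiffAt 𝓘(ℝ, E) 𝓘(ℝ, E) ∞ (extChartAt 𝓘(ℝ, E) p).symm x :=
  (contMDiffOn_extChartAt_symm p).contMDiffAt ((isOpen_target p).mem_nhds hx)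

theorem contDiffAt_fieldRep {X : Π y : M, TangentSpace 𝓘(ℝ, E) y}
    (hX : ContMDiff 𝓘(ℝ, E) 𝓘(ℝ, E).tangent ∞
      (fun x ↦ (⟨x, X x⟩ : TangentBundle 𝓘(ℝ, E) M)))
    {x : E} (hx : x ∈ (extChartAt 𝓘(ℝ, E) p).target) : ContDiffAt ℝ ∞ (fieldRep p X) x := by
  have h1 := (Trivialization.contMDiffAt_section_iff
    (trivializationAt E (TangentSpace 𝓘(ℝ, E)) p) (by exact symm_mem hx)).1
      (hX.contMDiffAt (x := (extChartAt 𝓘(ℝ, E) p).symm x))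
  refine ((h1.comp x (contMDiffAt_symm hx)).congr_of_eventuallyEq ?_).contDiffAt
  filter_upwards [(isOpen_target p).mem_nhds hx] with z hz
  exact coordMap_apply (symm_mem hz) _

theorem differentiableAt_comp_symm {F : Type*} [NormedAddCommGroup F] [NormedSpace ℝ F] {f : M → F}
    (hy : y ∈ (chartAt E p).source) (hf : MDiffAt f y) :
    DifferentiableAt ℝ (f ∘ (extChartAt 𝓘(ℝ, E) p).symm) (extChartAt 𝓘(ℝ, E) p y) := by
  rw [← mdifferentiableAt_iff_differentiableAt]
  refine MDifferentiableAt.comp (I' := 𝓘(ℝ, E)) _ ?_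
    ((contMDiffAt_symm (chart_mem hy)).mdifferentiableAt (by simp))
  rwa [symm_chart hy]

theorem hasMFDerivAt_of_comp_symm {F : Type*} [NormedAddCommGroup F] [NormedSpace ℝ F] {f : M → F}
    (hy : y ∈ (chartAt E p).source) {f' : E →L[ℝ] F}
    (hf : HasFDerivAt (f ∘ (extChartAt 𝓘(ℝ, E) p).symm) f' (extChartAt 𝓘(ℝ, E) p y)) :
    HasMFDerivAt 𝓘(ℝ, E) 𝓘(ℝ, F) f y (f'.comp (coordMap p y)) := by
  have h1 : HasMFDerivAt 𝓘(ℝ, E) 𝓘(ℝ, E) (extChartAt 𝓘(ℝ, E) p) y (coordMap p y) := by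
    rw [← mfderiv_extChartAt hy]
    exact (mdifferentiableAt_extChartAt hy).hasMFDerivAt
  refine (hf.hasMFDerivAt.comp y h1).congr_of_eventuallyEq ?_
  filter_upwards [(chartAt E p).open_source.mem_nhds hy] with z hz
  simp only [Function.comp_apply, symm_chart hz]

theorem mvfderiv_apply {F : Type*} [NormedAddCommGroup F] [NormedSpace ℝ F] {f : M → F}
    (hy : y ∈ (chartAt E p).source) (hf : MDiffAt f y) (v : TangentSpace 𝓘(ℝ, E) y) :
    d% f y v =
      fderiv ℝ (f ∘ (extChartAt 𝓘(ℝ, E) p).symm) (extChartAt 𝓘(ℝ, E) p y) (coordMap p y v) := by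
  rw [mvfderiv, (hasMFDerivAt_of_comp_symm hy
    (differentiableAt_comp_symm hy hf).hasFDerivAt).mfderiv]
  rfl

theorem mdifferentiableAt_coordMap (hy : y ∈ (chartAt E p).source)
    {X : Π y : M, TangentSpace 𝓘(ℝ, E) y} (hX : MDiffAt (T% X) y) :
    MDiffAt (fun z ↦ coordMap p z (X z)) y := by
  refine ((Trivialization.mdifferentiableAt_section_iff 𝓘(ℝ, E)
    (trivializationAt E (TangentSpace 𝓘(ℝ, E)) p) X (by exact hy)).1 hX).congr_of_eventuallyEq ?_
  filter_upwards [(chartAt E p).open_source.mem_nhds hy] with z hz using coordMap_apply hz _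

theorem differentiableAt_fieldRep (hy : y ∈ (chartAt E p).source)
    {X : Π y : M, TangentSpace 𝓘(ℝ, E) y} (hX : MDiffAt (T% X) y) :
    DifferentiableAt ℝ (fieldRep p X) (extChartAt 𝓘(ℝ, E) p y) :=
  differentiableAt_comp_symm hy (mdifferentiableAt_coordMap hy hX)

theorem mdifferentiableAt_of_fieldRep {y : M} (hy : y ∈ (chartAt E p).source)
    {X : Π y : M, TangentSpace 𝓘(ℝ, E) y}
    (hX : DifferentiableAt ℝ (fieldRep p X) (extChartAt 𝓘(ℝ, E) p y)) : MDiffAt (T% X) y := by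
  have h : MDiffAt (fun z ↦ coordMap p z (X z)) y :=
    (hasMFDerivAt_of_comp_symm (f := fun z ↦ coordMap p z (X z)) hy
      hX.hasFDerivAt).mdifferentiableAt
  refine (Trivialization.mdifferentiableAt_section_iff 𝓘(ℝ, E)
    (trivializationAt E (TangentSpace 𝓘(ℝ, E)) p) X (by exact hy)).2 (h.congr_of_eventuallyEq ?_)
  filter_upwards [(chartAt E p).open_source.mem_nhds hy] with z hz using (coordMap_apply hz _).symm

variable [CompleteSpace E]

/-- Coordinate vector fields commute. -/
theorem mlieBracket_coordField (hy : y ∈ (chartAt E p).source) (v w : E) :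
    mlieBracket 𝓘(ℝ, E) (coordField p v) (coordField p w) y = 0 := by
  have h2 : IsManifold 𝓘(ℝ, E) (minSmoothness ℝ 2) M := by
    rw [minSmoothness_of_isRCLikeNormedField]; infer_instance
  have h2' : IsManifold 𝓘(ℝ, E) (minSmoothness ℝ 2) E := by
    rw [minSmoothness_of_isRCLikeNormedField]; infer_instance
  let c (u : E) (x : E) : TangentSpace 𝓘(ℝ, E) x := u
  -- The coordinate fields are pullbacks, by the chart, of constant vector fields on `E`.
  have hpull (u : E) : coordField p u =ᶠ[𝓝 y]
      mpullback 𝓘(ℝ, E) 𝓘(ℝ, E) (extChartAt 𝓘(ℝ, E) p) (c u) := by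
    filter_upwards [(chartAt E p).open_source.mem_nhds hy] with z hz
    have hinv := isInvertible_mfderiv_extChartAt (I := 𝓘(ℝ, E)) (x := p) (y := z)
      (by rwa [extChartAt_source])
    refine (hinv.inverse_apply_eq.2 ?_).symm
    rw [mfderiv_extChartAt hz]
    exact (coordMap_coordField hz u).symm
  have hconst (u : E) : MDiffAt (T% (c u)) (extChartAt 𝓘(ℝ, E) p y) :=
    (contMDiffAt_vectorSpace_iff_contDiffAt.2
      (contDiffAt_const (n := 1) (c := u))).mdifferentiableAt one_ne_zero
  have hzero : mlieBracket 𝓘(ℝ, E) (c v) (c w) = 0 := by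
    rw [← mlieBracketWithin_univ, mlieBracketWithin_eq_lieBracketWithin, lieBracketWithin_univ]
    funext x
    change fderiv ℝ (fun _ : E ↦ w) x v - fderiv ℝ (fun _ : E ↦ v) x w = 0
    simp
  have h := mpullback_mlieBracket (n := ∞) (hconst v) (hconst w)
      (contMDiffAt_extChartAt' hy)
      (by simpa only [minSmoothness_of_isRCLikeNormedField] using ENat.LEInfty.out)
  rw [(hpull v).mlieBracket_vectorField_eq (hpull w), ← h, hzero, mpullback_zero]
  rfl

end Chart

/-! ### The Levi-Civita connection in a chart -/

section LocalConnection

variable {E : Type*} [NormedAddCommGroup E] [NormedSpace ℝ E]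
  {M : Type*} [TopologicalSpace M] [ChartedSpace E M] [IsManifold 𝓘(ℝ, E) ∞ M]
  [RiemannianBundle (fun x : M ↦ TangentSpace 𝓘(ℝ, E) x)]

/-- The Riemannian metric in the chart at `p`, as a function on `E` with values in bilinear
forms. It is only meaningful on the target of the chart. -/
def metricRep (p : M) (x : E) : E →L[ℝ] E →L[ℝ] ℝ :=
  (innerSL ℝ (E := TangentSpace 𝓘(ℝ, E) ((extChartAt 𝓘(ℝ, E) p).symm x))).bilinearComp
    ((trivializationAt E (TangentSpace 𝓘(ℝ, E)) p).symmL ℝ ((extChartAt 𝓘(ℝ, E) p).symm x))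
    ((trivializationAt E (TangentSpace 𝓘(ℝ, E)) p).symmL ℝ ((extChartAt 𝓘(ℝ, E) p).symm x))

variable {p y : M} {X : Π y : M, TangentSpace 𝓘(ℝ, E) y}

theorem metricRep_apply {x : E} (hx : x ∈ (extChartAt 𝓘(ℝ, E) p).target) (v w : E) :
    metricRep p x v w = inner ℝ (coordField p v ((extChartAt 𝓘(ℝ, E) p).symm x))
      (coordField p w ((extChartAt 𝓘(ℝ, E) p).symm x)) := by
  rw [coordField_eq_symmL (symm_mem hx), coordField_eq_symmL (symm_mem hx)]
  rfl

theorem metricRep_chart (hy : y ∈ (chartAt E p).source) (v w : E) :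
    metricRep p (extChartAt 𝓘(ℝ, E) p y) v w =
      inner ℝ (coordField p v y) (coordField p w y) := by
  rw [metricRep_apply (chart_mem hy), symm_chart hy]

variable
  [IsContMDiffRiemannianBundle 𝓘(ℝ, E) ∞ E (fun x : M ↦ TangentSpace 𝓘(ℝ, E) x)]

theorem mdifferentiableAt_inner_coordField (hy : y ∈ (chartAt E p).source) (v w : E) :
    MDiffAt (fun z ↦ inner ℝ (coordField p v z) (coordField p w z)) y :=
  mdiff_inner (mdifferentiableAt_coordField hy v) (mdifferentiableAt_coordField hy w)

variable [FiniteDimensional ℝ E]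

theorem isMetricOn_metricRep (p : M) :
    IsMetricOn (metricRep p) (extChartAt 𝓘(ℝ, E) p).target where
  isOpen := isOpen_target p
  contDiffOn := by
    refine contDiffOn_clm_apply.2 fun v ↦ contDiffOn_clm_apply.2 fun w x hx ↦ ?_
    refine ContDiffAt.contDiffWithinAt ?_
    have h1 : CMDiffAt ∞ (fun y ↦ inner ℝ (coordField p v y) (coordField p w y))
        ((extChartAt 𝓘(ℝ, E) p).symm x) :=
      ContMDiffAt.inner_bundle (IB := 𝓘(ℝ, E)) (F := E) (E := fun x : M ↦ TangentSpace 𝓘(ℝ, E) x)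
        (b := fun y ↦ y) (contMDiffAt_coordField (symm_mem hx) v)
        (contMDiffAt_coordField (symm_mem hx) w)
    refine ((h1.comp x (contMDiffAt_symm hx)).congr_of_eventuallyEq ?_).contDiffAt
    filter_upwards [(isOpen_target p).mem_nhds hx] with z hz using metricRep_apply hz v w
  symm x hx v w := by
    rw [metricRep_apply hx, metricRep_apply hx, real_inner_comm]
  pos x hx v hv := by
    rw [metricRep_apply hx]
    refine real_inner_self_pos.2 fun h ↦ hv ?_
    rw [← coordMap_coordField (symm_mem hx) v, h, map_zero]

/-- The Christoffel symbols of the Levi-Civita connection in the chart at `p`. -/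
def chartChristoffel (p : M) : E → E →L[ℝ] E →L[ℝ] E := christoffel (metricRep p)

theorem mvfderiv_inner_coordField (hy : y ∈ (chartAt E p).source) (u v w : E) :
    d% (fun z ↦ inner ℝ (coordField p v z) (coordField p w z)) y (coordField p u y) =
      fderiv ℝ (metricRep p) (extChartAt 𝓘(ℝ, E) p y) u v w := by
  rw [mvfderiv_apply hy (mdifferentiableAt_inner_coordField hy v w), coordMap_coordField hy]
  have h := ((isMetricOn_metricRep p).differentiableAt (chart_mem hy)).hasFDerivAt
  have h1 : HasFDerivAt (fun x ↦ metricRep p x v w)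
      (((fderiv ℝ (metricRep p) (extChartAt 𝓘(ℝ, E) p y)).flip v).flip w)
      (extChartAt 𝓘(ℝ, E) p y) := by
    simpa using (h.clm_apply (hasFDerivAt_const v _)).clm_apply (hasFDerivAt_const w _)
  have h2 := h1.congr_of_eventuallyEq (f₁ := (fun z ↦ inner ℝ (coordField p v z)
    (coordField p w z)) ∘ (extChartAt 𝓘(ℝ, E) p).symm) (by
      filter_upwards [(isOpen_target p).mem_nhds (chart_mem hy)] with z hz
      exact (metricRep_apply hz v w).symm)
  rw [h2.fderiv]
  rfl

/-- The Levi-Civita connection on coordinate fields is given by the Christoffel symbols: the Lie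
bracket terms of the Koszul formula vanish. -/
theorem leviCivita_coordField (hy : y ∈ (chartAt E p).source) (u w : E) :
    leviCivita (coordField p w) y (coordField p u y) =
      coordField p (chartChristoffel p (extChartAt 𝓘(ℝ, E) p y) u w) y := by
  have := FiniteDimensional.complete ℝ E
  refine ext_inner_right ℝ fun z ↦ mul_left_cancel₀ (two_ne_zero (α := ℝ)) ?_
  obtain ⟨z, rfl⟩ : ∃ z', coordField p z' y = z := ⟨_, coordField_coordMap hy z⟩
  rw [two_mul_inner_leviCivita (mdifferentiableAt_coordField hy u)
    (mdifferentiableAt_coordField hy w) (mdifferentiableAt_coordField hy z),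
    ← metricRep_chart hy, chartChristoffel,
    (isMetricOn_metricRep p).apply_christoffel (chart_mem hy), christoffelLower_apply]
  simp only [koszul, mlieBracket_coordField hy, mvfderiv_inner_coordField hy, inner_zero_left]
  ring

theorem leviCivita_sum {ι : Type*} (s : Finset ι) {Y : ι → Π y : M, TangentSpace 𝓘(ℝ, E) y}
    (hY : ∀ i ∈ s, MDiffAt (T% (Y i)) y) :
    leviCivita (fun z ↦ ∑ i ∈ s, Y i z) y = ∑ i ∈ s, leviCivita (Y i) y := by
  classical
  induction s using Finset.induction_on with
  | empty =>
    simp only [Finset.sum_empty]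
    exact (leviCivita (I := 𝓘(ℝ, E)) (M := M)).isCovariantDerivativeOnUniv.zero
  | insert i s hi ih =>
    simp only [Finset.mem_insert, forall_eq_or_imp] at hY
    simp only [Finset.sum_insert hi]
    rw [← ih hY.2]
    exact leviCivita.isCovariantDerivativeOnUniv.add hY.1 (MDifferentiableAt.sum_section hY.2)

/-- The Levi-Civita connection in the chart at `p`: `∇_v X = ∂_v X + Γ(v, X)`. -/
theorem coordMap_leviCivita (hy : y ∈ (chartAt E p).source) (hX : MDiffAt (T% X) y)
    (v : TangentSpace 𝓘(ℝ, E) y) :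
    coordMap p y (leviCivita X y v) =
      covDiff (chartChristoffel p) (fieldRep p X) (extChartAt 𝓘(ℝ, E) p y) (coordMap p y v) := by
  let b := Module.finBasis ℝ E
  let β (i) : E →L[ℝ] ℝ := (b.coord i).toContinuousLinearMap
  have hb (w : E) : ∑ i, β i w • b i = w := b.sum_repr w
  let f (i) (z : M) : ℝ := β i (coordMap p z (X z))
  have hf (i) : MDiffAt (f i) y :=
    (β i).differentiableAt.mdifferentiableAt.comp y (mdifferentiableAt_coordMap hy hX)
  have hfC (i) : MDiffAt (T% (f i • coordField p (b i))) y :=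
    (hf i).smul_section (mdifferentiableAt_coordField hy (b i))
  -- Expand `X` in the coordinate frame and apply the Leibniz rule to each term.
  have hexp : ∀ᶠ z in 𝓝 y, X z = ∑ i, (f i • coordField p (b i)) z := by
    filter_upwards [(chartAt E p).open_source.mem_nhds hy] with z hz
    refine coordMap_injective hz ?_
    simp [map_sum, coordMap_coordField hz, f, hb]
  have hdf (i) : d% (f i) y v =
      β i (fderiv ℝ (fieldRep p X) (extChartAt 𝓘(ℝ, E) p y) (coordMap p y v)) := by
    rw [mvfderiv_apply hy (hf i)]
    have h : HasFDerivAt (f i ∘ (extChartAt 𝓘(ℝ, E) p).symm) _ (extChartAt 𝓘(ℝ, E) p y) :=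
      (β i).hasFDerivAt.comp _ (differentiableAt_fieldRep hy hX).hasFDerivAt
    rw [h.fderiv]
    rfl
  have hval : fieldRep p X (extChartAt 𝓘(ℝ, E) p y) = coordMap p y (X y) := by
    rw [fieldRep, symm_chart hy]
  have hleib (i) : leviCivita (f i • coordField p (b i)) y =
      f i y • leviCivita (coordField p (b i)) y + (d% (f i) y).smulRight (coordField p (b i) y) :=
    leviCivita.isCovariantDerivativeOnUniv.leibniz (mdifferentiableAt_coordField hy (b i)) (hf i)
  have hC (i) : coordMap p y (leviCivita (coordField p (b i)) y v) =
      chartChristoffel p (extChartAt 𝓘(ℝ, E) p y) (coordMap p y v) (b i) := by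
    conv_lhs => rw [← coordField_coordMap hy v]
    rw [leviCivita_coordField hy, coordMap_coordField hy]
  have hterm (i) : coordMap p y (leviCivita (f i • coordField p (b i)) y v) =
      f i y • chartChristoffel p (extChartAt 𝓘(ℝ, E) p y) (coordMap p y v) (b i)
        + d% (f i) y v • b i := by
    rw [hleib, _root_.add_apply, _root_.smul_apply, ContinuousLinearMap.smulRight_apply, map_add,
      map_smul, map_smul, hC, coordMap_coordField hy]
  rw [leviCivita.isCovariantDerivativeOnUniv.congr_of_eventuallyEq hX
    (MDifferentiableAt.sum_section fun i _ ↦ hfC i) Filter.univ_mem hexp,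
    leviCivita_sum _ fun i _ ↦ hfC i, _root_.sum_apply, map_sum]
  simp only [hterm, hdf, Finset.sum_add_distrib, hb, covDiff, _root_.add_apply,
    ContinuousLinearMap.flip_apply, hval]
  rw [add_comm]
  congr 1
  conv_rhs => rw [← hb (coordMap p y (X y)), map_sum]
  simp only [map_smul]
  rfl

end LocalConnection

/-! ### Covariant derivatives along curves and geodesics -/

section AlongCurves

variable {E : Type*} [NormedAddCommGroup E] [NormedSpace ℝ E]
  {M : Type*} [TopologicalSpace M] [ChartedSpace E M] [IsManifold 𝓘(ℝ, E) ∞ M]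
  {γ : ℝ → M} {t : ℝ} {p : M}

theorem hasDerivAt_chart (hγ : MDifferentiableAt 𝓘(ℝ, ℝ) 𝓘(ℝ, E) γ t)
    (ht : γ t ∈ (chartAt E p).source) :
    HasDerivAt (fun s ↦ extChartAt 𝓘(ℝ, E) p (γ s))
      (coordMap p (γ t) (velocity (I := 𝓘(ℝ, E)) γ t)) t := by
  have h1 : HasMFDerivAt 𝓘(ℝ, E) 𝓘(ℝ, E) (extChartAt 𝓘(ℝ, E) p) (γ t) (coordMap p (γ t)) := by
    rw [← mfderiv_extChartAt ht]
    exact (mdifferentiableAt_extChartAt ht).hasMFDerivAt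
  have h2 : HasFDerivAt (fun s ↦ extChartAt 𝓘(ℝ, E) p (γ s))
      ((coordMap p (γ t)).comp (mfderiv 𝓘(ℝ, ℝ) 𝓘(ℝ, E) γ t) : ℝ →L[ℝ] E) t :=
    (h1.comp t hγ.hasMFDerivAt).hasFDerivAt
  exact h2.hasDerivAt

variable {c : ℝ → E}

theorem mdifferentiableAt_symm_comp (hc : DifferentiableAt ℝ c t)
    (ht : c t ∈ (extChartAt 𝓘(ℝ, E) p).target) :
    MDifferentiableAt 𝓘(ℝ, ℝ) 𝓘(ℝ, E) (fun s ↦ (extChartAt 𝓘(ℝ, E) p).symm (c s)) t :=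
  ((contMDiffAt_symm ht).mdifferentiableAt (by simp)).comp t hc.mdifferentiableAt

theorem coordMap_velocity_symm_comp (hc : DifferentiableAt ℝ c t)
    (ht : c t ∈ (extChartAt 𝓘(ℝ, E) p).target) :
    coordMap p ((extChartAt 𝓘(ℝ, E) p).symm (c t))
      (velocity (I := 𝓘(ℝ, E)) (fun s ↦ (extChartAt 𝓘(ℝ, E) p).symm (c s)) t) = deriv c t := by
  rw [← (hasDerivAt_chart (mdifferentiableAt_symm_comp hc ht) (symm_mem ht)).deriv]
  refine Filter.EventuallyEq.deriv_eq ?_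
  filter_upwards [hc.continuousAt ((isOpen_target p).mem_nhds ht)] with r hr
  exact (extChartAt 𝓘(ℝ, E) p).right_inv hr

variable [RiemannianBundle (fun x : M ↦ TangentSpace 𝓘(ℝ, E) x)]
  [IsContMDiffRiemannianBundle 𝓘(ℝ, E) ∞ E (fun x : M ↦ TangentSpace 𝓘(ℝ, E) x)]
  [FiniteDimensional ℝ E]

/-- The covariant derivative along `γ`, in the chart at `γ t` that its definition refers to. -/
theorem coordMap_covDerivAlong_self (hγ : ContinuousAt γ t)
    (V : Π s : ℝ, TangentSpace 𝓘(ℝ, E) (γ s)) :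
    coordMap (γ t) (γ t) (covDerivAlong leviCivita γ V t) =
      deriv (fun s ↦ coordMap (γ t) (γ s) (V s)) t
        + chartChristoffel (γ t) (extChartAt 𝓘(ℝ, E) (γ t) (γ t))
          (coordMap (γ t) (γ t) (velocity γ t)) (coordMap (γ t) (γ t) (V t)) := by
  have hq : γ t ∈ (chartAt E (γ t)).source := mem_chart_source E (γ t)
  have hev : (fun s ↦ coordMap (γ t) (γ s) (V s)) =ᶠ[𝓝 t]
      fun s ↦ (trivializationAt E (TangentSpace 𝓘(ℝ, E)) (γ t) ⟨γ s, V s⟩).2 := by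
    filter_upwards [hγ ((chartAt E (γ t)).open_source.mem_nhds hq)] with s hs
    exact coordMap_apply hs _
  rw [hev.deriv_eq, covDerivAlong, map_add]
  congr 1
  · exact coordMap_coordField hq _
  · rw [extend_eq_coordField]
    conv_lhs => rw [← coordField_coordMap hq (velocity γ t)]
    rw [leviCivita_coordField hq, coordMap_coordField hq]

/-- The Leibniz rule for a field along `γ` which is a combination, with coefficients depending on
the time, of restrictions of vector fields. -/
theorem covDerivAlong_sum_smul (hγ : MDifferentiableAt 𝓘(ℝ, ℝ) 𝓘(ℝ, E) γ t)
    {ι : Type*} [Fintype ι] {f : ι → ℝ → ℝ} {f' : ι → ℝ} (hf : ∀ i, HasDerivAt (f i) (f' i) t)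
    {Y : ι → Π y : M, TangentSpace 𝓘(ℝ, E) y} (hY : ∀ i, MDiffAt (T% (Y i)) (γ t))
    {V : Π s : ℝ, TangentSpace 𝓘(ℝ, E) (γ s)} (hV : ∀ᶠ s in 𝓝 t, V s = ∑ i, f i s • Y i (γ s)) :
    covDerivAlong leviCivita γ V t =
      ∑ i, (f' i • Y i (γ t) + f i t • leviCivita (Y i) (γ t) (velocity γ t)) := by
  have hq : γ t ∈ (chartAt E (γ t)).source := mem_chart_source E (γ t)
  refine coordMap_injective hq ?_
  rw [coordMap_covDerivAlong_self hγ.continuousAt]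
  have hval (i) : coordMap (γ t) (γ t) (Y i (γ t)) =
      fieldRep (γ t) (Y i) (extChartAt 𝓘(ℝ, E) (γ t) (γ t)) := by
    rw [fieldRep, symm_chart hq]
  have hη (i) : HasDerivAt (fun s ↦ fieldRep (γ t) (Y i) (extChartAt 𝓘(ℝ, E) (γ t) (γ s)))
      (fderiv ℝ (fieldRep (γ t) (Y i)) (extChartAt 𝓘(ℝ, E) (γ t) (γ t))
        (coordMap (γ t) (γ t) (velocity γ t))) t :=
    HasFDerivAt.comp_hasDerivAt (f := fun s ↦ extChartAt 𝓘(ℝ, E) (γ t) (γ s)) t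
      (differentiableAt_fieldRep hq (hY i)).hasFDerivAt (hasDerivAt_chart hγ hq)
  have hev : (fun s ↦ coordMap (γ t) (γ s) (V s)) =ᶠ[𝓝 t]
      fun s ↦ ∑ i, f i s • fieldRep (γ t) (Y i) (extChartAt 𝓘(ℝ, E) (γ t) (γ s)) := by
    filter_upwards [hV, hγ.continuousAt ((chartAt E (γ t)).open_source.mem_nhds hq)] with s hs hs'
    rw [hs, map_sum]
    refine Finset.sum_congr rfl fun i _ ↦ ?_
    rw [map_smul, fieldRep, symm_chart hs']
  have hsum := HasDerivAt.fun_sum fun i (_ : i ∈ Finset.univ) ↦ (hf i).fun_smul (hη i)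
  rw [hev.deriv_eq, hsum.deriv, hV.self_of_nhds]
  simp only [map_sum, map_add, map_smul, coordMap_leviCivita hq (hY _), hval, covDiff,
    _root_.add_apply, ContinuousLinearMap.flip_apply, smul_add, ← Finset.sum_add_distrib]
  refine Finset.sum_congr rfl fun i _ ↦ ?_
  abel

/-- The covariant derivative along `γ`, in any chart. -/
theorem coordMap_covDerivAlong (hγ : MDifferentiableAt 𝓘(ℝ, ℝ) 𝓘(ℝ, E) γ t)
    (ht : γ t ∈ (chartAt E p).source) {V : Π s : ℝ, TangentSpace 𝓘(ℝ, E) (γ s)} {v' : E}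
    (hV : HasDerivAt (fun s ↦ coordMap p (γ s) (V s)) v' t) :
    coordMap p (γ t) (covDerivAlong leviCivita γ V t) =
      v' + chartChristoffel p (extChartAt 𝓘(ℝ, E) p (γ t))
        (coordMap p (γ t) (velocity γ t)) (coordMap p (γ t) (V t)) := by
  let b := Module.finBasis ℝ E
  let β (i) : E →L[ℝ] ℝ := (b.coord i).toContinuousLinearMap
  have hb (w : E) : ∑ i, β i w • b i = w := b.sum_repr w
  have hexp : ∀ᶠ s in 𝓝 t, V s = ∑ i, β i (coordMap p (γ s) (V s)) • coordField p (b i) (γ s) := by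
    filter_upwards [hγ.continuousAt ((chartAt E p).open_source.mem_nhds ht)] with s hs
    refine coordMap_injective hs ?_
    simp only [map_sum, map_smul, coordMap_coordField hs, hb]
  have hC (i) : coordMap p (γ t) (leviCivita (coordField p (b i)) (γ t) (velocity γ t)) =
      chartChristoffel p (extChartAt 𝓘(ℝ, E) p (γ t)) (coordMap p (γ t) (velocity γ t)) (b i) := by
    conv_lhs => rw [← coordField_coordMap ht (velocity γ t)]
    rw [leviCivita_coordField ht, coordMap_coordField ht]
  have hβ (i) : HasDerivAt (fun s ↦ β i (coordMap p (γ s) (V s))) (β i v') t :=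
    (β i).hasFDerivAt.comp_hasDerivAt t hV
  rw [covDerivAlong_sum_smul hγ hβ (fun i ↦ mdifferentiableAt_coordField ht (b i)) hexp]
  simp only [map_sum, map_add, map_smul, coordMap_coordField ht, hC, Finset.sum_add_distrib, hb]
  congr 1
  conv_rhs => rw [← hb (coordMap p (γ t) (V t)), map_sum]
  simp only [map_smul]

/-- The covariant derivative along `γ` of the restriction of a vector field `X` is `∇_{γ'} X`. -/
theorem covDerivAlong_comp {X : Π y : M, TangentSpace 𝓘(ℝ, E) y}
    (hγ : MDifferentiableAt 𝓘(ℝ, ℝ) 𝓘(ℝ, E) γ t) (hX : MDiffAt (T% X) (γ t)) :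
    covDerivAlong leviCivita γ (fun s ↦ X (γ s)) t = leviCivita X (γ t) (velocity γ t) := by
  rw [covDerivAlong_sum_smul (ι := Unit) hγ (fun _ ↦ hasDerivAt_const t (1 : ℝ)) (fun _ ↦ hX)
    (by simp)]
  simp

/-- A solution of the geodesic equation in the chart at `p` is a geodesic of `M`. -/
theorem isGeodesicOn_symm_comp {c : ℝ → E} {a b : ℝ}
    (hc : ContDiffOn ℝ ∞ c (Set.Ioo a b))
    (hmem : ∀ s ∈ Set.Ioo a b, c s ∈ (extChartAt 𝓘(ℝ, E) p).target)
    (heq : ∀ s ∈ Set.Ioo a b,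
      deriv (deriv c) s = - chartChristoffel p (c s) (deriv c s) (deriv c s)) :
    IsGeodesicOn 𝓘(ℝ, E) (fun s ↦ (extChartAt 𝓘(ℝ, E) p).symm (c s)) (Set.Ioo a b) := by
  refine ⟨isOpen_Ioo, Set.ordConnected_Ioo,
    (contMDiffOn_extChartAt_symm p).comp hc.contMDiffOn hmem, fun t ht ↦ ?_⟩
  have hcd (s) (hs : s ∈ Set.Ioo a b) : DifferentiableAt ℝ c s :=
    (hc.contDiffAt (isOpen_Ioo.mem_nhds hs)).differentiableAt (by simp)
  have hd : HasDerivAt (deriv c) (deriv (deriv c) t) t :=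
    (((hc.deriv_of_isOpen (m := 1) isOpen_Ioo
      (one_add_one_eq_two.trans_le ENat.LEInfty.out)).contDiffAt
        (isOpen_Ioo.mem_nhds ht)).differentiableAt (by simp)).hasDerivAt
  have hV := hd.congr_of_eventuallyEq (f₁ := fun s ↦ coordMap p _
      (velocity (I := 𝓘(ℝ, E)) (fun s ↦ (extChartAt 𝓘(ℝ, E) p).symm (c s)) s)) (by
    filter_upwards [isOpen_Ioo.mem_nhds ht] with r hr
    exact coordMap_velocity_symm_comp (hcd r hr) (hmem r hr))
  refine coordMap_injective (symm_mem (hmem t ht)) ?_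
  rw [coordMap_covDerivAlong (mdifferentiableAt_symm_comp (hcd t ht) (hmem t ht))
      (symm_mem (hmem t ht)) hV, coordMap_velocity_symm_comp (hcd t ht) (hmem t ht),
    (extChartAt 𝓘(ℝ, E) p).right_inv (hmem t ht), heq t ht, map_zero, neg_add_cancel]

end AlongCurves

/-! ### The curvature, the Jacobi equation and the divergence in a chart -/

section Divergence

variable {E : Type*} [NormedAddCommGroup E] [NormedSpace ℝ E]
  {M : Type*} [TopologicalSpace M] [ChartedSpace E M] [IsManifold 𝓘(ℝ, E) ∞ M]
  {p : M} [RiemannianBundle (fun x : M ↦ TangentSpace 𝓘(ℝ, E) x)]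
  [IsContMDiffRiemannianBundle 𝓘(ℝ, E) ∞ E (fun x : M ↦ TangentSpace 𝓘(ℝ, E) x)]
  [FiniteDimensional ℝ E]

/-- The second covariant derivative entering the definition of the curvature, in the chart. -/
theorem coordMap_leviCivita_leviCivita_extend (u v w : TangentSpace 𝓘(ℝ, E) p) :
    coordMap p p (leviCivita (fun y ↦ leviCivita (extend E w) y (extend E v y)) p u) =
      fderiv ℝ (chartChristoffel p) (extChartAt 𝓘(ℝ, E) p p) (coordMap p p u) (coordMap p p v)
          (coordMap p p w)
        + chartChristoffel p (extChartAt 𝓘(ℝ, E) p p) (coordMap p p u)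
          (chartChristoffel p (extChartAt 𝓘(ℝ, E) p p) (coordMap p p v) (coordMap p p w)) := by
  have hp : p ∈ (chartAt E p).source := mem_chart_source E p
  have hrep : fieldRep p (fun y ↦ leviCivita (extend E w) y (extend E v y))
      =ᶠ[𝓝 (extChartAt 𝓘(ℝ, E) p p)]
      fun x ↦ chartChristoffel p x (coordMap p p v) (coordMap p p w) := by
    filter_upwards [(isOpen_target p).mem_nhds (chart_mem hp)] with x hx
    rw [fieldRep, extend_eq_coordField, extend_eq_coordField, leviCivita_coordField (symm_mem hx),
      coordMap_coordField (symm_mem hx), (extChartAt 𝓘(ℝ, E) p).right_inv hx]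
  have hΓ := ((isMetricOn_metricRep p).christoffel_differentiableAt (chart_mem hp)).hasFDerivAt
  have h1 : HasFDerivAt
      (fun x ↦ chartChristoffel p x (coordMap p p v) (coordMap p p w))
      (((fderiv ℝ (chartChristoffel p) (extChartAt 𝓘(ℝ, E) p p)).flip
        (coordMap p p v)).flip (coordMap p p w)) (extChartAt 𝓘(ℝ, E) p p) := by
    simpa [chartChristoffel] using (hΓ.clm_apply (hasFDerivAt_const (coordMap p p v) _)).clm_apply
      (hasFDerivAt_const (coordMap p p w) _)
  have h2 := h1.congr_of_eventuallyEq hrep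
  rw [coordMap_leviCivita hp (mdifferentiableAt_of_fieldRep hp h2.differentiableAt), covDiff,
    h2.fderiv, hrep.self_of_nhds]
  rfl

/-- The curvature at `p` in the chart at `p`. The point is called `q` as well, since it will be the
value of a curve, which need not be definitionally `p`. -/
theorem coordMap_curvature {q : M} (hq : q = p) (u v w : TangentSpace 𝓘(ℝ, E) q) :
    coordMap p q (curvature leviCivita q u v w) =
      riemann (chartChristoffel p) (extChartAt 𝓘(ℝ, E) p q) (coordMap p q u) (coordMap p q v)
        (coordMap p q w) := by
  subst hq
  have := FiniteDimensional.complete ℝ E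
  have hbr : mlieBracket 𝓘(ℝ, E) (extend E u) (extend E v) q = 0 := by
    rw [extend_eq_coordField, extend_eq_coordField,
      mlieBracket_coordField (mem_chart_source E q)]
  rw [curvature, hbr, map_zero, sub_zero, map_sub, coordMap_leviCivita_leviCivita_extend,
    coordMap_leviCivita_leviCivita_extend, riemann]
  abel

variable {X : Π x : M, TangentSpace 𝓘(ℝ, E) x}

/-- The Jacobi equation at time `0` along the geodesic through `p` with velocity `v`. -/
theorem IsGlobalJacobi.secondCovDiff_add_riemann (hJ : IsGlobalJacobi X)
    (hX : ContMDiff 𝓘(ℝ, E) 𝓘(ℝ, E).tangent ∞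
      (fun x ↦ (⟨x, X x⟩ : TangentBundle 𝓘(ℝ, E) M))) (p : M) (v : E) :
    secondCovDiff (chartChristoffel p) (fieldRep p X) (extChartAt 𝓘(ℝ, E) p p) v v
      + riemann (chartChristoffel p) (extChartAt 𝓘(ℝ, E) p p)
        (fieldRep p X (extChartAt 𝓘(ℝ, E) p p)) v v = 0 := by
  have := FiniteDimensional.complete ℝ E
  have hp : p ∈ (chartAt E p).source := mem_chart_source E p
  have hg := isMetricOn_metricRep (E := E) p
  obtain ⟨c, ε, hε, hc, hmem, hc0, hv, heq⟩ := exists_geodesic_equation hg.isOpen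
    hg.contDiffOn_christoffel (chart_mem hp) v
  have h0 : (0 : ℝ) ∈ Set.Ioo (-ε) ε := ⟨by linarith, hε⟩
  have hcd (s) (hs : s ∈ Set.Ioo (-ε) ε) : DifferentiableAt ℝ c s :=
    (hc.contDiffAt (isOpen_Ioo.mem_nhds hs)).differentiableAt (by simp)
  have hd : HasDerivAt (deriv c) (- chartChristoffel p (extChartAt 𝓘(ℝ, E) p p) v v) 0 := by
    have h := (((hc.deriv_of_isOpen (m := 1) isOpen_Ioo
      (one_add_one_eq_two.trans_le ENat.LEInfty.out)).contDiffAt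
        (isOpen_Ioo.mem_nhds h0)).differentiableAt (by simp)).hasDerivAt
    rwa [heq 0 h0, hc0, hv] at h
  have hmd (y : M) : MDiffAt (T% X) y := hX.contMDiffAt.mdifferentiableAt (by simp)
  have hjac := hJ _ _ (isGeodesicOn_symm_comp hc hmem heq) 0 h0
  set γ : ℝ → M := fun s ↦ (extChartAt 𝓘(ℝ, E) p).symm (c s)
  have hγ0 : γ 0 = p := by simp only [γ, hc0, symm_chart hp]
  have hγd (s) (hs : s ∈ Set.Ioo (-ε) ε) : MDifferentiableAt 𝓘(ℝ, ℝ) 𝓘(ℝ, E) γ s :=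
    mdifferentiableAt_symm_comp (hcd s hs) (hmem s hs)
  have hvel (s) (hs : s ∈ Set.Ioo (-ε) ε) :
      coordMap p (γ s) (velocity (I := 𝓘(ℝ, E)) γ s) = deriv c s :=
    coordMap_velocity_symm_comp (hcd s hs) (hmem s hs)
  have hchart (s) (hs : s ∈ Set.Ioo (-ε) ε) : extChartAt 𝓘(ℝ, E) p (γ s) = c s :=
    (extChartAt 𝓘(ℝ, E) p).right_inv (hmem s hs)
  -- Near time `0`, the first covariant derivative of `X` along `γ` is `∇_{γ'} X`.
  have hfirst (s) (hs : s ∈ Set.Ioo (-ε) ε) :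
      coordMap p (γ s) (covDerivAlong leviCivita γ (fun t ↦ X (γ t)) s) =
        covDiff (chartChristoffel p) (fieldRep p X) (c s) (deriv c s) := by
    rw [covDerivAlong_comp (hγd s hs) (hmd _), coordMap_leviCivita (symm_mem (hmem s hs)) (hmd _),
      hvel s hs, hchart s hs]
  have hξ : ContDiffAt ℝ ∞ (fieldRep p X) (c 0) := contDiffAt_fieldRep hX (hmem 0 h0)
  have hA := hg.hasDerivAt_covDiff_deriv (hmem 0 h0) hξ (hcd 0 h0) hd
  have hV := hA.congr_of_eventuallyEq (f₁ := fun s ↦ coordMap p (γ s)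
      (covDerivAlong leviCivita γ (fun t ↦ X (γ t)) s)) (by
    filter_upwards [isOpen_Ioo.mem_nhds h0] with s hs using hfirst s hs)
  have hval : coordMap p (γ 0) (X (γ 0)) = fieldRep p X (extChartAt 𝓘(ℝ, E) p p) := by
    rw [fieldRep, ← hc0]
  have h := congrArg (coordMap p (γ 0)) hjac
  rw [map_add, map_zero, coordMap_curvature hγ0, coordMap_covDerivAlong (hγd 0 h0)
    (symm_mem (hmem 0 h0)) hV, hfirst 0 h0, hvel 0 h0, hchart 0 h0, hc0, hv, hval] at h
  rw [← h, secondCovDiff, map_neg, chartChristoffel]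
  abel

theorem divergence_eq_trace {y : M} (hy : y ∈ (chartAt E p).source) (hX : MDiffAt (T% X) y) :
    divergence X y = LinearMap.trace ℝ E
      (covDiff (chartChristoffel p) (fieldRep p X) (extChartAt 𝓘(ℝ, E) p y)).toLinearMap := by
  let e : TangentSpace 𝓘(ℝ, E) y ≃ₗ[ℝ] E := LinearEquiv.ofBijective (coordMap p y).toLinearMap
    ⟨coordMap_injective hy, fun w ↦ ⟨_, coordMap_coordField hy w⟩⟩
  rw [divergence, ← LinearMap.trace_conj' _ e]
  congr 1
  ext w
  obtain ⟨v, rfl⟩ := e.surjective w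
  rw [LinearEquiv.conj_apply_apply, e.symm_apply_apply]
  exact coordMap_leviCivita hy hX v

/-- The divergence of a global Jacobi field is critical at every point. -/
theorem IsGlobalJacobi.hasMFDerivAt_divergence (hJ : IsGlobalJacobi X)
    (hX : ContMDiff 𝓘(ℝ, E) 𝓘(ℝ, E).tangent ∞
      (fun x ↦ (⟨x, X x⟩ : TangentBundle 𝓘(ℝ, E) M))) (p : M) :
    HasMFDerivAt 𝓘(ℝ, E) 𝓘(ℝ, ℝ) (divergence X) p 0 := by
  have hp : p ∈ (chartAt E p).source := mem_chart_source E p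
  have h := (isMetricOn_metricRep p).hasFDerivAt_trace_covDiff (chart_mem hp)
    (contDiffAt_fieldRep hX (chart_mem hp)) (hJ.secondCovDiff_add_riemann hX p)
  have h' := hasMFDerivAt_of_comp_symm hp (f := divergence X) (h.congr_of_eventuallyEq (by
    filter_upwards [(isOpen_target p).mem_nhds (chart_mem hp)] with x hx
    rw [Function.comp_apply, divergence_eq_trace (symm_mem hx)
      (hX.contMDiffAt.mdifferentiableAt (by simp)), (extChartAt 𝓘(ℝ, E) p).right_inv hx]
    rfl))
  rwa [ContinuousLinearMap.zero_comp] at h'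

end Divergence

/-! ### Functions with vanishing derivative -/

section LocallyConstant

variable {E : Type*} [NormedAddCommGroup E] [NormedSpace ℝ E]
  {M : Type*} [TopologicalSpace M] [ChartedSpace E M] [IsManifold 𝓘(ℝ, E) ∞ M]

theorem isLocallyConstant_of_hasMFDerivAt_zero {f : M → ℝ}
    (hf : ∀ x, HasMFDerivAt 𝓘(ℝ, E) 𝓘(ℝ, ℝ) f x 0) : IsLocallyConstant f := by
  refine (IsLocallyConstant.iff_eventually_eq f).2 fun p ↦ ?_
  have hp : p ∈ (chartAt E p).source := mem_chart_source E p
  obtain ⟨r, hr, hball⟩ := Metric.isOpen_iff.1 (isOpen_target (E := E) p) _ (chart_mem hp)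
  have hder (x) (hx : x ∈ Metric.ball (extChartAt 𝓘(ℝ, E) p p) r) :
      HasFDerivAt (f ∘ (extChartAt 𝓘(ℝ, E) p).symm) (0 : E →L[ℝ] ℝ) x := by
    have h := (hf ((extChartAt 𝓘(ℝ, E) p).symm x)).comp x
      ((contMDiffAt_symm (hball hx)).mdifferentiableAt (by simp)).hasMFDerivAt
    rw [ContinuousLinearMap.zero_comp] at h
    exact h.hasFDerivAt
  have hcont : ContinuousAt (extChartAt 𝓘(ℝ, E) p) p := continuousAt_extChartAt p
  filter_upwards [(chartAt E p).open_source.mem_nhds hp,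
    hcont (Metric.ball_mem_nhds _ hr)] with y hy hyr
  have h := Metric.isOpen_ball.is_const_of_fderiv_eq_zero
    (convex_ball (extChartAt 𝓘(ℝ, E) p p) r).isPreconnected
    (fun x hx ↦ (hder x hx).differentiableAt.differentiableWithinAt)
    (fun x hx ↦ (hder x hx).fderiv) hyr (Metric.mem_ball_self hr)
  simpa only [Function.comp_apply, symm_chart hy, symm_chart hp] using h

end LocallyConstant

end Riem

end

theorem lemma3p1 {E : Type*} [NormedAddCommGroup E] [NormedSpace ℝ E] [FiniteDimensional ℝ E]
    {M : Type*} [TopologicalSpace M] [ChartedSpace E M] [IsManifold 𝓘(ℝ, E) ∞ M]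
    [RiemannianBundle (fun x : M ↦ TangentSpace 𝓘(ℝ, E) x)]
    [IsContMDiffRiemannianBundle 𝓘(ℝ, E) ∞ E (fun x : M ↦ TangentSpace 𝓘(ℝ, E) x)]
    [PreconnectedSpace M]
    (X : Π x : M, TangentSpace 𝓘(ℝ, E) x)
    (hX : ContMDiff 𝓘(ℝ, E) 𝓘(ℝ, E).tangent ∞
      (fun x ↦ (⟨x, X x⟩ : TangentBundle 𝓘(ℝ, E) M)))
    (hJ : Riem.IsGlobalJacobi X) :
    ∃ c : ℝ, ∀ x : M, Riem.divergence X x = c := by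
  rcases isEmpty_or_nonempty M with h | ⟨⟨p⟩⟩
  · exact ⟨0, fun x ↦ h.elim x⟩
  · exact ⟨Riem.divergence X p, fun x ↦
      (Riem.isLocallyConstant_of_hasMFDerivAt_zero
        (hJ.hasMFDerivAt_divergence hX)).apply_eq_of_preconnectedSpace x p⟩
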